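/- **Theorem 1.** An *R-vine tree sequence* on $J$ variables is a sequence of trees $T_1,\dots,T_{J-1}$ such that $T_1$ has node set $\{1,\dots,J\}$, for $i\ge 2$ the nodes of $T_i$ are the edges of $T_{i-1}$, and (proximity) two nodes joined by an edge of $T_i$, $i\ge 2$, share, as edges of $T_{i-1}$, a common node. For a node $a$ let $U_a\subseteq\{1,\dots,J\}$ be the set of variables reachable from it ($U_i=\{i\}$ for nodes $i$ of $T_1$, and $U_{\{a,b\}}=U_a\cup U_b$). An edge $e=\{a,b\}$ has conditioning set $D_e=U_a\cap U_b$ and two conditioned variables $l,m$, given by $U_a\setminus D_e=\{l\}$ and $U_b\setminus D_e=\{m\}$; the pair copula attached to $e$ is said to be the pair copula of $(Y_l,Y_m)$. Let $\mathbf Y=(Y_1,\dots,Y_J)$ be a random vector with a joint (Lebesgue) density that follows a simplified R-vine distribution with tree sequence $T_1,\dots,T_{J-1}$, with marginal distributions $F_1,\dots,F_J$, and with a bivariate (not necessarily symmetric) copula $C_e$ for each edge $e$ of each tree. That is, $Y_i\sim F_i$ for every $i$, and for every edge $e$ with conditioned variables $l,m$ and for almost every value $\mathbf y$ of $\mathbf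 Y_{D_e}$, the copula of the conditional distribution of $(Y_l,Y_m)$ given $\mathbf Y_{D_e}=\mathbf y$ is $C_e$, which does not depend on $\mathbf y$ (simplifying assumption). Suppose that all pair copulas in the trees $T_j,T_{j+1},\dots,T_{J-1}$ are the independence copula $(s,t)\mapsto st$. Then every pair of variables $Y_u,Y_v$ whose pair copula is attached to an edge of one of the trees $T_j,\dots,T_{J-1}$ is conditionally independent given all the remaining variables: $Y_u\perp\!\!\!\perp Y_v\mid \mathbf Y_{-u,v}$. -/

import Mathlib

open MeasureTheory ProbabilityTheory Set

noncomputable section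

namespace Vine

/-! ### Bivariate copulas -/

/-- A bivariate copula: a grounded, 2-increasing function on the unit square with uniform margins. -/
@[ext]
structure BivCopula where
  toFun : unitInterval → unitInterval → unitInterval
  zero_left : ∀ v, toFun 0 v = 0
  zero_right : ∀ u, toFun u 0 = 0
  one_left : ∀ v, toFun 1 v = v
  one_right : ∀ u, toFun u 1 = u
  two_increasing : ∀ u u' v v', u ≤ u' → v ≤ v' →
    (0 : ℝ) ≤ (toFun u' v' : ℝ) - toFun u v' - toFun u' v + toFun u v

/-- The independence copula `(u, v) ↦ u * v`. -/
def BivCopula.indep : BivCopula where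
  toFun u v := u * v
  zero_left v := zero_mul v
  zero_right u := mul_zero u
  one_left v := one_mul v
  one_right u := mul_one u
  two_increasing u u' v v' hu hv := by
    have h1 : (0 : ℝ) ≤ (u' : ℝ) - u := sub_nonneg.2 hu
    have h2 : (0 : ℝ) ≤ (v' : ℝ) - v := sub_nonneg.2 hv
    have h3 := mul_nonneg h1 h2
    push_cast
    linarith

/-- The distribution function of a law on the line, with values in the unit interval. -/
def cdfI (ρ : Measure ℝ) (s : ℝ) : unitInterval :=
  ⟨cdf ρ s, cdf_nonneg ρ s, cdf_le_one ρ s⟩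

/-- `C` is a copula of the law `ρ` on the plane: the joint distribution function of `ρ` is `C`
applied to the two marginal distribution functions. -/
def BivCopula.IsCopulaOf (C : BivCopula) (ρ : Measure (ℝ × ℝ)) : Prop :=
  ∀ s t : ℝ, ρ.real (Iic s ×ˢ Iic t) = (C.toFun (cdfI ρ.fst s) (cdfI ρ.snd t) : ℝ)

/-! ### Regular vines -/

/-- The possible nodes of the trees of a vine on `J` variables: a node of the first tree is a
variable, and a node of the next tree is an unordered pair (edge) of nodes of the present tree. -/
abbrev Node (J : ℕ) : ℕ → Type
  | 0 => Fin J
  | k + 1 => Sym2 (Node J k)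

/-- The set of variables reachable from a node (its complete union). -/
def Node.vars {J : ℕ} : (k : ℕ) → Node J k → Finset (Fin J)
  | 0, i => {(show Fin J from i)}
  | k + 1, e => Sym2.lift ⟨fun a b : Node J k => Node.vars k a ∪ Node.vars k b,
      fun _ _ => Finset.union_comm _ _⟩ (show Sym2 (Node J k) from e)

end Vine

open Vine

/-- A regular vine tree sequence on `J` variables. In the usual numbering `T_1, …, T_{J-1}`, the
graph `tree k` is `T_{k+1}`, so that the relevant indices are those with `k + 1 < J`. -/
structure RVine (J : ℕ) where
  tree : (k : ℕ) → (⊤ : SimpleGraph (Node J k)).Subgraph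
  /-- The nodes of the first tree are all the variables. -/
  verts_zero : (tree 0).verts = Set.univ
  /-- The nodes of each further tree are the edges of the tree before it. -/
  verts_succ : ∀ k, k + 2 < J → (tree (k + 1)).verts = (tree k).edgeSet
  isTree : ∀ k, k + 1 < J → (tree k).coe.IsTree
  /-- Proximity: two nodes joined in a tree are edges of the tree before it with a common node. -/
  proximity : ∀ k, k + 2 < J → ∀ a b : Sym2 (Node J k), (tree (k + 1)).Adj a b →
    ∃ n, n ∈ a ∧ n ∈ b

namespace RVine

variable {J : ℕ}

/-- `{a, b}` is an edge of `tree k` whose conditioned variables are `l` (on the side of `a`) and `m`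
(on the side of `b`), that is, whose pair copula couples the variables `l` and `m`. -/
def IsPair (V : RVine J) (k : ℕ) (a b : Node J k) (l m : Fin J) : Prop :=
  (V.tree k).Adj a b ∧ Node.vars k a \ Node.vars k b = {l} ∧ Node.vars k b \ Node.vars k a = {m}

/-- The conditioning set of the edge `{a, b}`. -/
def condSet (k : ℕ) (a b : Node J k) : Finset (Fin J) :=
  Node.vars k a ∩ Node.vars k b

end RVine

/-- The random vector `Y` has the regular vine distribution with marginal laws `F`, tree sequence `V`
and pair copulas `B`, under the simplifying assumption: `Y` has a joint density, and for every edge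
`{a, b}` of every tree, with conditioned variables `l`, `m` and conditioning set `D`, the copula
`B k a b` is the copula of the conditional law of `(Y_l, Y_m)` given `Y_D = y`, the same one for
(almost) every value `y`. Pair copulas need not be symmetric, so they are indexed by oriented edges;
`B k b a` is the copula of `(Y_m, Y_l)`. -/
structure IsRVineDistribution {J : ℕ} {Ω : Type*} [MeasurableSpace Ω]
    (μ : Measure Ω) [IsProbabilityMeasure μ] (Y : Ω → Fin J → ℝ)
    (F : Fin J → Measure ℝ) (V : RVine J)
    (B : (k : ℕ) → Node J k → Node J k → BivCopula) : Prop where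
  measurable : Measurable Y
  hasPDF : HasPDF Y μ volume
  margin : ∀ i, μ.map (fun ω => Y ω i) = F i
  pairCopula : ∀ k, k + 1 < J → ∀ (a b : Node J k) (l m : Fin J), V.IsPair k a b l m →
    ∀ᵐ y ∂(μ.map fun ω => (RVine.condSet k a b).restrict (Y ω)),
      (B k a b).IsCopulaOf
        (condDistrib (fun ω => (Y ω l, Y ω m))
          (fun ω => (RVine.condSet k a b).restrict (Y ω)) μ y)

/-- Conditional independence of two real random variables `X`, `Z` given a random variable `W`, on an
arbitrary probability space: `P(X ∈ s, Z ∈ t | W) = P(X ∈ s | W) P(Z ∈ t | W)` almost surely. -/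
def CondIndepGiven {Ω β : Type*} [MeasurableSpace Ω] [mβ : MeasurableSpace β]
    (μ : Measure Ω) (X Z : Ω → ℝ) (W : Ω → β) : Prop :=
  ∀ s t : Set ℝ, MeasurableSet s → MeasurableSet t →
    μ⟦X ⁻¹' s ∩ Z ⁻¹' t | mβ.comap W⟧ =ᵐ[μ]
      μ⟦X ⁻¹' s | mβ.comap W⟧ * μ⟦Z ⁻¹' t | mβ.comap W⟧

/-- On a standard Borel space this is Mathlib's conditional independence. -/
theorem condIndepGiven_iff_condIndepFun {Ω β : Type*} [MeasurableSpace Ω] [StandardBorelSpace Ω]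
    [mβ : MeasurableSpace β] (μ : Measure Ω) [IsFiniteMeasure μ] (X Z : Ω → ℝ) (W : Ω → β)
    (hX : Measurable X) (hZ : Measurable Z) (hW : Measurable W) :
    CondIndepGiven μ X Z W ↔ CondIndepFun (mβ.comap W) hW.comap_le X Z μ := by
  rw [condIndepFun_iff _ _ _ _ hX hZ]
  constructor
  · rintro h _ _ ⟨s, hs, rfl⟩ ⟨t, ht, rfl⟩
    exact h s t hs ht
  · intro h s t hs ht
    exact h _ _ ⟨s, hs, rfl⟩ ⟨t, ht, rfl⟩

end

/-!
The joint density of a vector factorizes along its vine, and the factors that come from independence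
copulas are trivial, so that no factor involves both variables of a late pair.

To make this work without densities of copulas, write `f_S` for the density of the variables in `S`.
An edge `{a, b}` with the independence copula says that its two conditioned variables are
conditionally independent given the conditioning set `D`, that is, `f_{a ∪ b} = f_a f_b / f_D`
(`margDensity_insert_insert`). In the first tree `D` is empty, and otherwise `D` is the set of
variables of the node that `a` and `b` have in common (`RVine.exists_vars_eq_inter`). Going down
from the only edge of the last tree, the joint density becomes a product of powers of densities `f_S`,
where `S` is reachable from an edge of one of the trees before the `j`-th, or is a single variable.
Such a set `S` never contains both `u` and `v`: otherwise `{u, v}` would also be the pair of an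
earlier edge (`RVine.exists_separating`), but every pair of variables belongs to exactly one edge of
the vine. So each `f_S` does not depend on `u` or does not depend on `v`, the joint density is a
product of a function without `v` and a function without `u`
(`IsRVineDistribution.splits_margDensity`), and this is the conditional independence of `Y u` and
`Y v` given all other variables (`condIndepGiven_of_density_eq_mul`).

That a pair belongs to one edge only, and that every edge has two conditioned variables, is shown by
counting: each side of an edge has at most one conditioned variable, every pair occurs, and the
number of edges in all trees is the number of pairs (`RVine.image_edges`, `RVine.injOn_diff_edges`).

All densities are taken with respect to a product of standard Gaussian laws instead of Lebesgue
measure. Lebesgue measure is absolutely continuous with respect to it, and since it is a probability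
measure, integrating out some of the coordinates is an averaging operator, so that all marginal
densities can be regarded as functions on one and the same space.
-/

noncomputable section

open scoped ENNReal

/-! ### Integrating out coordinates against a product probability measure -/

section Lmarginal


variable {ι : Type*} [DecidableEq ι] (ρ : Measure ℝ)

theorem dependsOn_lmarginal (f : (ι → ℝ) → ℝ≥0∞) (s : Finset ι) :
    DependsOn (∫⋯∫⁻_s, f ∂fun _ => ρ) (s : Set ι)ᶜ :=
  fun _ _ h => lmarginal_congr _ f fun i hi => h i (by simpa using hi)

theorem DependsOn.lmarginal {f : (ι → ℝ) → ℝ≥0∞} {S : Set ι} (hf : DependsOn f S) (s : Finset ι) :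
    DependsOn (∫⋯∫⁻_s, f ∂fun _ => ρ) (S \ s) := by
  intro x y h
  refine lintegral_congr fun z => hf fun i hi => ?_
  simp only [Function.updateFinset_def]
  split_ifs with his
  · rfl
  · exact h i ⟨hi, by simpa using his⟩

omit [DecidableEq ι] in
theorem DependsOn.fun_mul {f g : (ι → ℝ) → ℝ≥0∞} {S : Set ι} (hf : DependsOn f S)
    (hg : DependsOn g S) : DependsOn (fun x => f x * g x) S :=
  fun _ _ h => congrArg₂ (· * ·) (hf h) (hg h)

theorem lmarginal_mul_of_dependsOn {g f : (ι → ℝ) → ℝ≥0∞} {s : Finset ι}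
    (hg : DependsOn g (s : Set ι)ᶜ) (hf : Measurable f) :
    (∫⋯∫⁻_s, (fun x => g x * f x) ∂fun _ => ρ) = fun x => g x * (∫⋯∫⁻_s, f ∂fun _ => ρ) x := by
  ext x
  simp only [MeasureTheory.lmarginal]
  rw [← lintegral_const_mul (g x) (f := fun z => f (Function.updateFinset x s z))
    (hf.comp measurable_updateFinset)]
  refine lintegral_congr fun z => ?_
  congr 1
  refine hg fun i hi => ?_
  have : i ∉ s := by simpa using hi
  simp [Function.updateFinset_def, this]

/-- Tonelli's theorem for a product of functions of one coordinate each. -/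
theorem lmarginal_prod [SigmaFinite ρ] {q : ι → ℝ → ℝ≥0∞} (hq : ∀ i, Measurable (q i))
    (s : Finset ι) :
    (∫⋯∫⁻_s, (fun x => ∏ i ∈ s, q i (x i)) ∂fun _ => ρ) = fun _ => ∏ i ∈ s, ∫⁻ t, q i t ∂ρ := by
  induction s using Finset.induction with
  | empty => simp
  | insert i s hi ih =>
    have hm : Measurable fun x : ι → ℝ => ∏ j ∈ s, q j (x j) :=
      Finset.measurable_fun_prod _ fun j _ => (hq j).comp (measurable_pi_apply j)
    have hd : DependsOn (fun x : ι → ℝ => q i (x i)) (s : Set ι)ᶜ :=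
      fun x y h => by simp only [h i (by simpa using hi)]
    ext x
    simp only [Finset.prod_insert hi]
    rw [lmarginal_insert _ (by fun_prop) hi,
      lmarginal_mul_of_dependsOn ρ hd hm, ih]
    simp [lintegral_mul_const _ (hq i)]

theorem volume_absolutelyContinuous_pi_gaussianReal [Fintype ι] :
    (volume : Measure (ι → ℝ)) ≪ Measure.pi fun _ : ι => gaussianReal 0 1 := by
  have hm : Measurable fun x : ι → ℝ => ∏ i, gaussianPDF 0 1 (x i) :=
    Finset.measurable_fun_prod _ fun i _ =>
      (measurable_gaussianPDF 0 1).comp (measurable_pi_apply i)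
  have e : Measure.pi (fun _ : ι => gaussianReal 0 1) =
      (volume : Measure (ι → ℝ)).withDensity fun x => ∏ i, gaussianPDF 0 1 (x i) := by
    refine Measure.pi_eq fun s hs => ?_
    rw [withDensity_apply _ (MeasurableSet.univ_pi hs),
      ← lintegral_indicator (MeasurableSet.univ_pi hs)]
    have h := congrFun (lmarginal_prod (ι := ι) volume
      (fun i => (measurable_gaussianPDF 0 1).indicator (hs i)) Finset.univ) 0
    rw [lmarginal_univ] at h
    simp only [gaussianReal_of_var_ne_zero 0 one_ne_zero, withDensity_apply _ (hs _)]
    simp only [lintegral_indicator (hs _)] at h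
    rw [← h, volume_pi]
    refine lintegral_congr fun x => ?_
    by_cases hx : x ∈ univ.pi s
    · rw [indicator_of_mem hx]
      exact Finset.prod_congr rfl fun i _ => (indicator_of_mem (hx i trivial) _).symm
    · rw [indicator_of_notMem hx]
      simp only [mem_univ_pi, not_forall] at hx
      obtain ⟨i, hi⟩ := hx
      exact (Finset.prod_eq_zero (Finset.mem_univ i) (indicator_of_notMem hi _)).symm
  rw [e]
  refine withDensity_absolutelyContinuous' hm.aemeasurable (ae_of_all _ fun x => ?_)
  exact Finset.prod_ne_zero_iff.2 fun i _ => (gaussianPDF_pos 0 one_ne_zero _).ne'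

variable [IsProbabilityMeasure ρ]

theorem lmarginal_of_dependsOn {f : (ι → ℝ) → ℝ≥0∞} {s : Finset ι}
    (hf : DependsOn f (s : Set ι)ᶜ) : (∫⋯∫⁻_s, f ∂fun _ => ρ) = f := by
  have h := lmarginal_mul_of_dependsOn ρ hf (measurable_const (a := (1 : ℝ≥0∞)))
  simp only [mul_one] at h
  rw [h]
  ext x
  simp [MeasureTheory.lmarginal]

variable [Fintype ι]

/-- A factor that does not depend on the coordinates in `s` sees the other factor only through its
average over these coordinates. -/
theorem lintegral_mul_lmarginal {g f : (ι → ℝ) → ℝ≥0∞} {s : Finset ι} (hg : Measurable g)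
    (hf : Measurable f) (hgs : DependsOn g (s : Set ι)ᶜ) :
    ∫⁻ x, g x * f x ∂Measure.pi (fun _ : ι => ρ) =
      ∫⁻ x, g x * (∫⋯∫⁻_s, f ∂fun _ => ρ) x ∂Measure.pi (fun _ : ι => ρ) := by
  have hm : Measurable (∫⋯∫⁻_s, f ∂fun _ : ι => ρ) := hf.lmarginal _
  refine lintegral_eq_of_lmarginal_eq s (hg.mul hf) (hg.mul hm) ?_
  rw [lmarginal_mul_of_dependsOn ρ hgs hf, lmarginal_mul_of_dependsOn ρ hgs hm,
    lmarginal_of_dependsOn ρ (dependsOn_lmarginal ρ f s)]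

/-- Two factors that each depend on only one of the coordinates `l`, `m` are averaged over these
coordinates independently. -/
theorem lintegral_mul_mul_lmarginal {q g h : (ι → ℝ) → ℝ≥0∞} {l m : ι} (hq : Measurable q)
    (hg : Measurable g) (hh : Measurable h) (hql : DependsOn q {l}ᶜ) (hqm : DependsOn q {m}ᶜ)
    (hgm : DependsOn g {m}ᶜ) (hhl : DependsOn h {l}ᶜ) :
    ∫⁻ x, q x * (g x * h x) ∂Measure.pi (fun _ : ι => ρ) =
      ∫⁻ x, q x * ((∫⋯∫⁻_{l}, g ∂fun _ => ρ) x * (∫⋯∫⁻_{m}, h ∂fun _ => ρ) x)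
        ∂Measure.pi (fun _ : ι => ρ) := by
  have hm : Measurable (∫⋯∫⁻_{m}, h ∂fun _ : ι => ρ) := hh.lmarginal _
  have e1 := lintegral_mul_lmarginal ρ (s := {m}) (hq.mul hg) hh
    (by simpa [Pi.mul_def] using hqm.fun_mul hgm)
  have e2 := lintegral_mul_lmarginal ρ (s := {l}) (hq.mul hm) hg
    (by simpa [Pi.mul_def] using hql.fun_mul ((hhl.lmarginal ρ {m}).mono sdiff_subset))
  simp only [Pi.mul_apply] at e1 e2
  calc _ = _ := by simp only [← mul_assoc]
    _ = _ := e1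
    _ = _ := by simp only [mul_right_comm]
    _ = _ := e2
    _ = _ := by refine lintegral_congr fun x => by ring

end Lmarginal

/-! ### Marginal densities and conditional distributions -/


/-- Two functions of a statistic `p` that integrate to the same value over all events generated by
`p` agree almost everywhere. -/
theorem ae_eq_of_map_withDensity_comp_eq {X Z : Type*} [MeasurableSpace X] [MeasurableSpace Z]
    {γ : Measure X} [IsFiniteMeasure γ] {p : X → Z} (hp : Measurable p) {q r : Z → ℝ≥0∞}
    (hq : Measurable q) (hr : Measurable r) (hfin : ∫⁻ x, q (p x) ∂γ ≠ ⊤)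
    (h : ∀ A, MeasurableSet A → ∫⁻ x in p ⁻¹' A, q (p x) ∂γ = ∫⁻ x in p ⁻¹' A, r (p x) ∂γ) :
    (fun x => q (p x)) =ᵐ[γ] fun x => r (p x) := by
  have e : (γ.map p).withDensity q = (γ.map p).withDensity r := by
    ext A hA
    rw [withDensity_apply _ hA, withDensity_apply _ hA, setLIntegral_map hA hq hp,
      setLIntegral_map hA hr hp, h A hA]
  rw [withDensity_eq_iff hq.aemeasurable hr.aemeasurable
    (by rwa [lintegral_map hq hp])] at e
  exact ae_of_ae_map hp.aemeasurable e

theorem indicator_eq_indicator_one_mul {X : Type*} (A : Set X) (g : X → ℝ≥0∞) :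
    A.indicator g = fun x => A.indicator 1 x * g x := by
  ext x
  by_cases hx : x ∈ A <;> simp [hx]

section Extend

variable {ι : Type*} [DecidableEq ι]

/-- The extension by zero of a vector indexed by `S`. -/
def Finset.extendZero (S : Finset ι) (w : S → ℝ) : ι → ℝ :=
  fun i => if h : i ∈ S then w ⟨i, h⟩ else 0

theorem Finset.measurable_extendZero (S : Finset ι) : Measurable S.extendZero := by
  refine measurable_pi_lambda _ fun i => ?_
  by_cases h : i ∈ S
  · simpa [Finset.extendZero, h] using measurable_pi_apply _
  · simp [Finset.extendZero, h]

theorem DependsOn.extendZero_restrict {β : Type*} {f : (ι → ℝ) → β} {S : Finset ι}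
    (hf : DependsOn f (S : Set ι)) (y : ι → ℝ) : f (S.extendZero (S.restrict y)) = f y :=
  hf fun i hi => by
    have : i ∈ S := hi
    simp [Finset.extendZero, this]

omit [DecidableEq ι] in
theorem Finset.dependsOn_comp_restrict {β : Type*} (S : Finset ι) (f : (S → ℝ) → β) :
    DependsOn (fun y : ι → ℝ => f (S.restrict y)) (S : Set ι) :=
  fun _ _ h => congrArg f (funext fun i => h i i.2)

/-- Two functions of the coordinates in `S` that integrate to the same value over all events that
concern these coordinates agree almost everywhere. -/
theorem ae_eq_of_setLIntegral_restrict_eq {γ : Measure (ι → ℝ)} [IsFiniteMeasure γ] {S : Finset ι}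
    {q r : (ι → ℝ) → ℝ≥0∞} (hq : Measurable q) (hr : Measurable r)
    (hqS : DependsOn q (S : Set ι)) (hrS : DependsOn r (S : Set ι)) (hfin : ∫⁻ x, q x ∂γ ≠ ⊤)
    (h : ∀ A : Set (S → ℝ), MeasurableSet A →
      ∫⁻ x in S.restrict ⁻¹' A, q x ∂γ = ∫⁻ x in S.restrict ⁻¹' A, r x ∂γ) : q =ᵐ[γ] r := by
  have := ae_eq_of_map_withDensity_comp_eq (γ := γ) (Finset.measurable_restrict (X := fun _ => ℝ) S)
    (hq.comp S.measurable_extendZero) (hr.comp S.measurable_extendZero)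
    (by simpa [hqS.extendZero_restrict] using hfin)
    (by simpa [hqS.extendZero_restrict, hrS.extendZero_restrict] using h)
  simpa [hqS.extendZero_restrict, hrS.extendZero_restrict] using this

end Extend

/-- The density of the coordinates in `S`, as a function on the whole space, when `f` is the joint
density with respect to a product of copies of the probability measure `ρ`: all other coordinates
are integrated out. -/
def margDensity {ι : Type*} [Fintype ι] [DecidableEq ι] (ρ : Measure ℝ) (f : (ι → ℝ) → ℝ≥0∞)
    (S : Finset ι) : (ι → ℝ) → ℝ≥0∞ :=
  ∫⋯∫⁻_Sᶜ, f ∂fun _ => ρ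

section Density

variable {ι : Type*} [Fintype ι] [DecidableEq ι] {ρ : Measure ℝ} [IsProbabilityMeasure ρ]
  {f : (ι → ℝ) → ℝ≥0∞}

theorem measurable_margDensity (hf : Measurable f) (S : Finset ι) :
    Measurable (margDensity ρ f S) :=
  hf.lmarginal _

omit [IsProbabilityMeasure ρ] in
theorem dependsOn_margDensity (S : Finset ι) : DependsOn (margDensity ρ f S) (S : Set ι) := by
  simpa [margDensity] using dependsOn_lmarginal ρ f Sᶜ

omit [IsProbabilityMeasure ρ] in
theorem margDensity_univ : margDensity ρ f Finset.univ = f := by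
  simp [margDensity]

variable {Ω : Type*} [MeasurableSpace Ω] {μ : Measure Ω} {Y : Ω → ι → ℝ}

omit [IsProbabilityMeasure ρ] [DecidableEq ι] in
theorem lintegral_comp_eq_lintegral_mul (hY : Measurable Y) (hf : Measurable f)
    (hlaw : μ.map Y = (Measure.pi fun _ => ρ).withDensity f) {q : (ι → ℝ) → ℝ≥0∞}
    (hq : Measurable q) :
    ∫⁻ ω, q (Y ω) ∂μ = ∫⁻ y, q y * f y ∂Measure.pi (fun _ => ρ) := by
  rw [← lintegral_map hq hY, hlaw, lintegral_withDensity_eq_lintegral_mul _ hf hq]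
  exact lintegral_congr fun y => mul_comm _ _

theorem lintegral_comp_eq_lintegral_mul_margDensity (hY : Measurable Y) (hf : Measurable f)
    (hlaw : μ.map Y = (Measure.pi fun _ => ρ).withDensity f) {q : (ι → ℝ) → ℝ≥0∞}
    (hq : Measurable q) {S : Finset ι} (hqS : DependsOn q (S : Set ι)) :
    ∫⁻ ω, q (Y ω) ∂μ = ∫⁻ y, q y * margDensity ρ f S y ∂Measure.pi (fun _ => ρ) := by
  rw [lintegral_comp_eq_lintegral_mul hY hf hlaw hq]
  exact lintegral_mul_lmarginal ρ hq hf (by simpa using hqS)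

theorem ae_margDensity_ne_zero (hY : Measurable Y) (hf : Measurable f)
    (hlaw : μ.map Y = (Measure.pi fun _ => ρ).withDensity f) (S : Finset ι) :
    ∀ᵐ ω ∂μ, margDensity ρ f S (Y ω) ≠ 0 := by
  have hm := measurable_margDensity (ρ := ρ) hf S
  have hz : MeasurableSet ({0} : Set ℝ≥0∞) := measurableSet_singleton 0
  have h := lintegral_comp_eq_lintegral_mul_margDensity hY hf hlaw (S := S)
    (q := fun y => ({0} : Set ℝ≥0∞).indicator 1 (margDensity ρ f S y))
    ((measurable_one.indicator hz).comp hm)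
    fun x y h => by simp only [dependsOn_margDensity S h]
  have h0 : ∀ x : ℝ≥0∞, ({0} : Set ℝ≥0∞).indicator 1 x * x = 0 := fun x => by
    by_cases hx : x = 0 <;> simp [hx]
  simp only [h0, lintegral_zero] at h
  rw [lintegral_eq_zero_iff (by exact (measurable_one.indicator hz).comp (hm.comp hY))] at h
  filter_upwards [h] with ω hω h1
  simp [h1] at hω

variable [IsProbabilityMeasure μ]

theorem lintegral_margDensity (hY : Measurable Y) (hf : Measurable f)
    (hlaw : μ.map Y = (Measure.pi fun _ => ρ).withDensity f) (S : Finset ι) :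
    ∫⁻ y, margDensity ρ f S y ∂Measure.pi (fun _ => ρ) = 1 := by
  have := lintegral_comp_eq_lintegral_mul_margDensity hY hf hlaw (q := fun _ => 1)
    measurable_const (S := S) fun _ _ _ => rfl
  simp only [one_mul] at this
  rw [← this]
  simp

theorem margDensity_lt_top (hY : Measurable Y) (hf : Measurable f)
    (hlaw : μ.map Y = (Measure.pi fun _ => ρ).withDensity f) (S : Finset ι) :
    ∀ᵐ y ∂Measure.pi (fun _ => ρ), margDensity ρ f S y < ⊤ :=
  ae_lt_top (measurable_margDensity hf S) (by simp [lintegral_margDensity hY hf hlaw S])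

/-- Bayes' formula: if the conditional probability of `X ∈ T` given the coordinates in `S` has
numerator `q`, it is the quotient of `q` by the density of these coordinates. -/
theorem condDistrib_mul_margDensity {E : Type*} [MeasurableSpace E] [StandardBorelSpace E]
    [Nonempty E] (hY : Measurable Y) (hf : Measurable f)
    (hlaw : μ.map Y = (Measure.pi fun _ => ρ).withDensity f) (S : Finset ι) {X : Ω → E}
    (hX : Measurable X) {T : Set E} (hT : MeasurableSet T) {q : (ι → ℝ) → ℝ≥0∞} (hq : Measurable q)
    (hqS : DependsOn q (S : Set ι))
    (h : ∀ A : Set (S → ℝ), MeasurableSet A →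
      ∫⁻ y in S.restrict ⁻¹' A, q y ∂Measure.pi (fun _ => ρ) =
        μ ((fun ω => S.restrict (Y ω)) ⁻¹' A ∩ X ⁻¹' T)) :
    (fun y => condDistrib X (fun ω => S.restrict (Y ω)) μ (S.restrict y) T * margDensity ρ f S y)
      =ᵐ[Measure.pi fun _ => ρ] q := by
  have hr : Measurable (S.restrict (π := fun _ => ℝ)) := Finset.measurable_restrict S
  have hrY : Measurable fun ω => S.restrict (Y ω) := hr.comp hY
  set κ := condDistrib X (fun ω => S.restrict (Y ω)) μ
  have hk : Measurable fun y : ι → ℝ => κ (S.restrict y) T := (Kernel.measurable_coe κ hT).comp hr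
  have key : ∀ A : Set (S → ℝ), MeasurableSet A →
      ∫⁻ y in S.restrict ⁻¹' A, κ (S.restrict y) T * margDensity ρ f S y ∂Measure.pi (fun _ => ρ) =
        μ ((fun ω => S.restrict (Y ω)) ⁻¹' A ∩ X ⁻¹' T) := by
    intro A hA
    have hkA : Measurable ((S.restrict ⁻¹' A).indicator fun y : ι → ℝ => κ (S.restrict y) T) :=
      hk.indicator (hr hA)
    have hd : DependsOn ((S.restrict ⁻¹' A).indicator fun y : ι → ℝ => κ (S.restrict y) T)
        (S : Set ι) := S.dependsOn_comp_restrict (A.indicator fun w => κ w T)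
    rw [← setLIntegral_preimage_condDistrib hrY hX.aemeasurable hT hA,
      ← lintegral_indicator (hr hA), ← lintegral_indicator (hrY hA)]
    have := lintegral_comp_eq_lintegral_mul_margDensity hY hf hlaw hkA hd
    simp only [indicator_mul_left]
    exact this.symm
  refine ae_eq_of_setLIntegral_restrict_eq (hk.mul (measurable_margDensity hf S)) hq
    ((S.dependsOn_comp_restrict fun w => κ w T).fun_mul (dependsOn_margDensity S)) hqS ?_
    fun A hA => (key A hA).trans (h A hA).symm
  have := key univ .univ
  simp only [preimage_univ, Measure.restrict_univ] at this
  rw [this]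
  exact measure_ne_top _ _

/-! ### Conditional independence and factorization of densities -/

/-- The numerator of the conditional probability of `Y l ∈ s` given the coordinates in `D`. -/
theorem condDistrib_mul_margDensity_eq_lmarginal {E : Type*} [MeasurableSpace E]
    [StandardBorelSpace E] [Nonempty E] (hY : Measurable Y) (hf : Measurable f)
    (hlaw : μ.map Y = (Measure.pi fun _ => ρ).withDensity f) {D : Finset ι} {l : ι} (hl : l ∉ D)
    {X : Ω → E} (hX : Measurable X) {T : Set E} (hT : MeasurableSet T) {s : Set ℝ}
    (hs : MeasurableSet s) (hXT : X ⁻¹' T = {ω | Y ω l ∈ s}) :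
    (fun y => condDistrib X (fun ω => D.restrict (Y ω)) μ (D.restrict y) T * margDensity ρ f D y)
      =ᵐ[Measure.pi fun _ => ρ]
    ∫⋯∫⁻_{l}, (fun y => s.indicator 1 (y l) * margDensity ρ f (insert l D) y) ∂fun _ => ρ := by
  have hr : Measurable (D.restrict (π := fun _ => ℝ)) := Finset.measurable_restrict D
  have his : Measurable fun y : ι → ℝ => s.indicator (1 : ℝ → ℝ≥0∞) (y l) :=
    (measurable_one.indicator hs).comp (measurable_pi_apply l)
  have hsd : DependsOn (fun y : ι → ℝ => s.indicator (1 : ℝ → ℝ≥0∞) (y l))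
      ((insert l D : Finset ι) : Set ι) := fun x y h => by simp only [h l (by simp)]
  have hm := his.mul (measurable_margDensity (ρ := ρ) hf (insert l D))
  refine condDistrib_mul_margDensity hY hf hlaw D hX hT (hm.lmarginal _) ?_ fun A hA => ?_
  · refine ((hsd.fun_mul (dependsOn_margDensity _)).lmarginal ρ {l}).mono ?_
    intro i hi
    simpa [hl] using hi
  have hAm : Measurable ((D.restrict ⁻¹' A).indicator (1 : (ι → ℝ) → ℝ≥0∞)) :=
    measurable_one.indicator (hr hA)
  have hAd : DependsOn ((D.restrict ⁻¹' A).indicator (1 : (ι → ℝ) → ℝ≥0∞)) (D : Set ι) :=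
    D.dependsOn_comp_restrict (A.indicator 1)
  -- The indicator of `A` does not see the coordinate `l`, so averaging over `l` changes nothing.
  have e := lintegral_mul_lmarginal ρ (s := {l}) hAm hm
    (hAd.mono fun i hi => by rintro h; simp_all)
  have e' := lintegral_comp_eq_lintegral_mul_margDensity hY hf hlaw (hAm.mul his)
    ((hAd.mono (by simp)).fun_mul hsd)
  rw [← lintegral_indicator (hr hA)]
  rw [indicator_eq_indicator_one_mul]
  refine e.symm.trans ?_
  simp only [Pi.mul_apply, ← mul_assoc] at e' ⊢
  have hms : MeasurableSet ((fun ω => D.restrict (Y ω)) ⁻¹' A ∩ {ω | Y ω l ∈ s}) :=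
    (hr.comp hY hA).inter (((measurable_pi_apply l).comp hY) hs)
  rw [← e', hXT, ← lintegral_indicator_one hms]
  refine lintegral_congr fun ω => ?_
  rw [inter_indicator_one]
  rfl

/-- If `Y l` and `Y m` are conditionally independent given the coordinates in `D`, then the density
of the coordinates in `D ∪ {l, m}` is the product of those in `D ∪ {l}` and in `D ∪ {m}`, divided by
the density of those in `D`. The quotient is harmless where the latter vanishes, because there the
left side and the product vanish, too. -/
theorem margDensity_insert_insert (hY : Measurable Y) (hf : Measurable f)
    (hlaw : μ.map Y = (Measure.pi fun _ => ρ).withDensity f) {D : Finset ι} {l m : ι} (hlm : l ≠ m)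
    (hl : l ∉ D) (hm : m ∉ D)
    (hind : ∀ᵐ w ∂(μ.map fun ω => D.restrict (Y ω)), ∀ s t : Set ℝ,
      MeasurableSet s → MeasurableSet t →
      condDistrib (fun ω => (Y ω l, Y ω m)) (fun ω => D.restrict (Y ω)) μ w (s ×ˢ t) =
        condDistrib (fun ω => (Y ω l, Y ω m)) (fun ω => D.restrict (Y ω)) μ w (s ×ˢ univ) *
        condDistrib (fun ω => (Y ω l, Y ω m)) (fun ω => D.restrict (Y ω)) μ w (univ ×ˢ t)) :
    margDensity ρ f (insert l (insert m D)) =ᵐ[Measure.pi fun _ => ρ] fun y =>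
      margDensity ρ f (insert l D) y * margDensity ρ f (insert m D) y *
        (margDensity ρ f D y)⁻¹ := by
  have hr : Measurable (D.restrict (π := fun _ => ℝ)) := Finset.measurable_restrict D
  have hX : Measurable fun ω => (Y ω l, Y ω m) := by fun_prop
  have hrY : Measurable fun ω => D.restrict (Y ω) := hr.comp hY
  set κ := condDistrib (fun ω => (Y ω l, Y ω m)) (fun ω => D.restrict (Y ω)) μ with hκ
  set γ : Measure (ι → ℝ) := Measure.pi fun _ => ρ
  set e := insert l (insert m D) with he
  have hsub : (D : Set ι) ⊆ (e : Set ι) := fun i hi => by simp_all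
  have hfD := measurable_margDensity (ρ := ρ) hf D
  have hfl := measurable_margDensity (ρ := ρ) hf (insert l D)
  have hfm := measurable_margDensity (ρ := ρ) hf (insert m D)
  have hfe := measurable_margDensity (ρ := ρ) hf e
  have hDl : (D : Set ι) ⊆ {l}ᶜ := fun i hi h => by simp_all
  have hDm : (D : Set ι) ⊆ {m}ᶜ := fun i hi h => by simp_all
  have hlDm : ((insert l D : Finset ι) : Set ι) ⊆ {m}ᶜ := fun i hi h => by simp_all
  have hmDl : ((insert m D : Finset ι) : Set ι) ⊆ {l}ᶜ := fun i hi h => by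
    simp only [mem_singleton_iff] at h
    subst h
    simp_all
  have hdl : DependsOn (margDensity ρ f (insert l D)) ((insert l D : Finset ι) : Set ι) :=
    dependsOn_margDensity _
  have hdm : DependsOn (margDensity ρ f (insert m D)) ((insert m D : Finset ι) : Set ι) :=
    dependsOn_margDensity _
  have hde : DependsOn (margDensity ρ f e) (e : Set ι) := dependsOn_margDensity _
  have hdD : DependsOn (fun y => (margDensity ρ f D y)⁻¹) (D : Set ι) := fun x y h => by
    simp only [dependsOn_margDensity D h]
  set r : (ι → ℝ) → ℝ≥0∞ := fun y =>
    margDensity ρ f (insert l D) y * margDensity ρ f (insert m D) y *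
      (margDensity ρ f D y)⁻¹ with hrdef
  have hrm : Measurable r := (hfl.mul hfm).mul hfD.inv
  have hrd : DependsOn r (e : Set ι) :=
    ((hdl.mono (by simp [he, insert_subset_insert])).fun_mul (hdm.mono (by simp [he]))).fun_mul
      (hdD.mono hsub)
  -- Both sides have the same integrals over the rectangles `y_D ∈ A`, `y_l ∈ s`, `y_m ∈ t`.
  have key : ∀ (A : Set (D → ℝ)) (s t : Set ℝ), MeasurableSet A → MeasurableSet s →
      MeasurableSet t →
      ∫⁻ y, (D.restrict ⁻¹' A).indicator 1 y * (s.indicator 1 (y l) * t.indicator 1 (y m)) *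
        margDensity ρ f e y ∂γ =
      ∫⁻ y, (D.restrict ⁻¹' A).indicator 1 y * (s.indicator 1 (y l) * t.indicator 1 (y m)) *
        r y ∂γ := by
    intro A s t hA hs ht
    have hAm : Measurable ((D.restrict ⁻¹' A).indicator (1 : (ι → ℝ) → ℝ≥0∞)) :=
      measurable_one.indicator (hr hA)
    have hAd : DependsOn ((D.restrict ⁻¹' A).indicator (1 : (ι → ℝ) → ℝ≥0∞)) (D : Set ι) :=
      D.dependsOn_comp_restrict (A.indicator 1)
    have hsm : Measurable fun y : ι → ℝ => s.indicator (1 : ℝ → ℝ≥0∞) (y l) :=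
      (measurable_one.indicator hs).comp (measurable_pi_apply l)
    have htm : Measurable fun y : ι → ℝ => t.indicator (1 : ℝ → ℝ≥0∞) (y m) :=
      (measurable_one.indicator ht).comp (measurable_pi_apply m)
    have hsd : ∀ S : Set ι, l ∈ S →
        DependsOn (fun y : ι → ℝ => s.indicator (1 : ℝ → ℝ≥0∞) (y l)) S :=
      fun S hS x y h => by simp only [h l hS]
    have htd : ∀ S : Set ι, m ∈ S →
        DependsOn (fun y : ι → ℝ => t.indicator (1 : ℝ → ℝ≥0∞) (y m)) S :=
      fun S hS x y h => by simp only [h m hS]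
    have hk : ∀ T, MeasurableSet T → Measurable fun y : ι → ℝ => κ (D.restrict y) T :=
      fun T hT => (Kernel.measurable_coe κ hT).comp hr
    have hkd : ∀ T, DependsOn (fun y : ι → ℝ => κ (D.restrict y) T) (D : Set ι) :=
      fun T => D.dependsOn_comp_restrict fun w => κ w T
    have hl' := condDistrib_mul_margDensity_eq_lmarginal hY hf hlaw hl hX
      (hs.prod .univ) hs (by ext ω; simp)
    have hm' := condDistrib_mul_margDensity_eq_lmarginal hY hf hlaw hm hX
      (MeasurableSet.univ.prod ht) ht (by ext ω; simp)
    rw [← hκ] at hl' hm'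
    have hst : MeasurableSet (s ×ˢ t) := hs.prod ht
    -- The left integral is the probability of the rectangle, which conditioning on `Y_D` and
    -- conditional independence turn into an integral of a product of conditional probabilities.
    have h1 : ∫⁻ y, (D.restrict ⁻¹' A).indicator 1 y * (s.indicator 1 (y l) * t.indicator 1 (y m)) *
        margDensity ρ f e y ∂γ =
        ∫⁻ ω, (D.restrict ⁻¹' A).indicator 1 (Y ω) * κ (D.restrict (Y ω)) (s ×ˢ t) ∂μ := by
      have := lintegral_comp_eq_lintegral_mul_margDensity hY hf hlaw
        (hAm.mul (hsm.mul htm)) (S := e)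
        ((hAd.mono hsub).fun_mul ((hsd _ (by simp [he])).fun_mul (htd _ (by simp [he]))))
      simp only [Pi.mul_apply] at this
      rw [← this]
      have h2 := setLIntegral_preimage_condDistrib (μ := μ) hrY hX.aemeasurable hst hA
      rw [← lintegral_indicator (hrY hA)] at h2
      have hms : MeasurableSet ((fun ω => D.restrict (Y ω)) ⁻¹' A ∩
        (fun ω => (Y ω l, Y ω m)) ⁻¹' s ×ˢ t) := (hrY hA).inter (hX hst)
      refine Eq.trans ?_ ((lintegral_indicator_one hms).trans (h2.symm.trans ?_))
      · refine lintegral_congr fun ω => ?_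
        have : (fun ω => (Y ω l, Y ω m)) ⁻¹' s ×ˢ t = {ω | Y ω l ∈ s} ∩ {ω | Y ω m ∈ t} := by
          ext; simp
        rw [this, inter_indicator_one, inter_indicator_one]
        rfl
      · refine lintegral_congr fun ω => ?_
        by_cases hω : D.restrict (Y ω) ∈ A
        · rw [indicator_of_mem (by exact hω), indicator_of_mem (by exact hω)]
          simp [hκ]
        · rw [indicator_of_notMem (by exact hω), indicator_of_notMem (by exact hω)]
          simp
    have h2 : ∫⁻ ω, (D.restrict ⁻¹' A).indicator 1 (Y ω) * κ (D.restrict (Y ω)) (s ×ˢ t) ∂μ =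
        ∫⁻ ω, (D.restrict ⁻¹' A).indicator 1 (Y ω) * (κ (D.restrict (Y ω)) (s ×ˢ univ) *
          κ (D.restrict (Y ω)) (univ ×ˢ t)) ∂μ := by
      refine lintegral_congr_ae ?_
      filter_upwards [ae_of_ae_map hrY.aemeasurable hind] with ω hω
      rw [hω s t hs ht]
    have h3 := lintegral_comp_eq_lintegral_mul_margDensity hY hf hlaw
      (hAm.mul ((hk _ (hs.prod .univ)).mul (hk _ (MeasurableSet.univ.prod ht)))) (S := D)
      (hAd.fun_mul ((hkd _).fun_mul (hkd _)))
    rw [h1, h2]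
    refine h3.trans ?_
    -- On the right, averaging over `l` and `m` turns the two densities into the numerators of these
    -- conditional probabilities.
    have h4 := lintegral_mul_mul_lmarginal ρ (l := l) (m := m) (hAm.mul hfD.inv) (hsm.mul hfl)
      (htm.mul hfm) ((hAd.fun_mul hdD).mono hDl) ((hAd.fun_mul hdD).mono hDm)
      (((hsd _ (by simp)).fun_mul hdl).mono hlDm) (((htd _ (by simp)).fun_mul hdm).mono hmDl)
    simp only [Pi.mul_apply, Pi.inv_apply] at h4
    refine Eq.trans ?_ (h4.symm.trans (lintegral_congr fun y => ?_))
    · refine lintegral_congr_ae ?_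
      filter_upwards [hl', hm', margDensity_lt_top hY hf hlaw D] with y hy1 hy2 hy3
      simp only [Pi.mul_def]
      rw [← hy1, ← hy2]
      by_cases h0 : margDensity ρ f D y = 0
      · simp [h0]
      · calc _ = (D.restrict ⁻¹' A).indicator 1 y * (κ (D.restrict y) (s ×ˢ univ) *
              κ (D.restrict y) (univ ×ˢ t)) * margDensity ρ f D y *
              (margDensity ρ f D y * (margDensity ρ f D y)⁻¹) := by
              rw [ENNReal.mul_inv_cancel h0 hy3.ne, mul_one]
          _ = _ := by ring
    · simp only [hrdef]
      ring
  -- The statistic `(y_D, y_l, y_m)` has the section `σ` on functions of these coordinates.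
  let p : (ι → ℝ) → (D → ℝ) × ℝ × ℝ := fun y => (D.restrict y, y l, y m)
  let σ : (D → ℝ) × ℝ × ℝ → ι → ℝ := fun z =>
    Function.update (Function.update (D.extendZero z.1) l z.2.1) m z.2.2
  have hp : Measurable p := hr.prodMk (by fun_prop)
  have hσ : Measurable σ := by
    refine measurable_update'.comp (Measurable.prodMk (measurable_update'.comp
      (Measurable.prodMk (D.measurable_extendZero.comp measurable_fst) ?_)) ?_) <;> fun_prop
  have hσp : ∀ q : (ι → ℝ) → ℝ≥0∞, DependsOn q (e : Set ι) → ∀ y, q (σ (p y)) = q y := by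
    intro q hq y
    refine hq fun i hi => ?_
    by_cases him : i = m
    · subst him; simp [σ, p]
    by_cases hil : i = l
    · subst hil; simp [σ, p, him]
    have hiD : i ∈ D := by simpa [he, him, hil] using hi
    simp [σ, p, him, hil, Finset.extendZero, hiD]
  have hfin : ∫⁻ y, margDensity ρ f e y ∂γ = 1 := lintegral_margDensity hY hf hlaw e
  have hmap : (γ.withDensity (margDensity ρ f e)).map p = (γ.withDensity r).map p := by
    have : IsFiniteMeasure (γ.withDensity (margDensity ρ f e)) :=
      isFiniteMeasure_withDensity (by simp [hfin])
    refine Measure.ext_prod₃ fun {A s t} hA hs ht => ?_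
    have hAst : MeasurableSet (A ×ˢ s ×ˢ t) := hA.prod (hs.prod ht)
    rw [Measure.map_apply hp hAst, Measure.map_apply hp hAst, withDensity_apply _ (hp hAst),
      withDensity_apply _ (hp hAst), ← lintegral_indicator (hp hAst),
      ← lintegral_indicator (hp hAst)]
    have e1 : ∀ q : (ι → ℝ) → ℝ≥0∞, (p ⁻¹' A ×ˢ s ×ˢ t).indicator q = fun y =>
        (D.restrict ⁻¹' A).indicator 1 y * (s.indicator 1 (y l) * t.indicator 1 (y m)) * q y := by
      intro q
      ext y
      have : p ⁻¹' A ×ˢ s ×ˢ t =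
          (D.restrict ⁻¹' A) ∩ ({y : ι → ℝ | y l ∈ s} ∩ {y : ι → ℝ | y m ∈ t}) := by
        ext; simp [p]
      by_cases h1 : D.restrict y ∈ A <;> by_cases h2 : y l ∈ s <;> by_cases h3 : y m ∈ t <;>
        simp [this, h1, h2, h3]
    rw [e1, e1]
    exact key A s t hA hs ht
  have := ae_eq_of_map_withDensity_comp_eq (γ := γ) hp (hfe.comp hσ) (hrm.comp hσ)
    (by simp [hσp _ hde, hfin]) fun A hA => by
      have h := congrArg (fun ν : Measure _ => ν A) hmap
      simp only [Measure.map_apply hp hA, withDensity_apply _ (hp hA)] at h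
      simpa [hσp _ hde, hσp _ hrd] using h
  simpa [hσp _ hde, hσp _ hrd] using this

/-- If the joint density is a product of two factors, one not depending on the coordinate `v` and
one not depending on the coordinate `u`, then `Y u` and `Y v` are conditionally independent given
all other coordinates. -/
theorem condIndepGiven_of_density_eq_mul (hY : Measurable Y) (hf : Measurable f)
    (hlaw : μ.map Y = (Measure.pi fun _ => ρ).withDensity f) {u v : ι} (huv : u ≠ v)
    {g h : (ι → ℝ) → ℝ≥0∞} (hg : Measurable g) (hh : Measurable h) (hgv : DependsOn g {v}ᶜ)
    (hhu : DependsOn h {u}ᶜ) (hfgh : f =ᵐ[Measure.pi fun _ => ρ] fun y => g y * h y) :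
    CondIndepGiven μ (fun ω => Y ω u) (fun ω => Y ω v)
      (fun ω => (({u, v} : Finset ι)ᶜ).restrict (Y ω)) := by
  intro s t hs ht
  set S : Finset ι := ({u, v} : Finset ι)ᶜ with hS
  have hr : Measurable (S.restrict (π := fun _ => ℝ)) := Finset.measurable_restrict S
  have hrY : Measurable fun ω => S.restrict (Y ω) := hr.comp hY
  have hX : Measurable fun ω => (Y ω u, Y ω v) := by fun_prop
  set γ : Measure (ι → ℝ) := Measure.pi fun _ => ρ
  set κ := condDistrib (fun ω => (Y ω u, Y ω v)) (fun ω => S.restrict (Y ω)) μ with hκ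
  -- Averaging over the coordinates `u` and `v` makes `G s * H t` the numerator of the conditional
  -- probability of `Y u ∈ s`, `Y v ∈ t`, a product of a function of `s` and a function of `t`.
  let G : Set ℝ → (ι → ℝ) → ℝ≥0∞ := fun s =>
    ∫⋯∫⁻_{u}, (fun y => s.indicator 1 (y u) * g y) ∂fun _ => ρ
  let H : Set ℝ → (ι → ℝ) → ℝ≥0∞ := fun t =>
    ∫⋯∫⁻_{v}, (fun y => t.indicator 1 (y v) * h y) ∂fun _ => ρ
  have hSu : (S : Set ι) ⊆ {u}ᶜ := fun i hi h => by simp_all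
  have hSv : (S : Set ι) ⊆ {v}ᶜ := fun i hi h => by simp_all
  have hSuv : {v}ᶜ \ {u} ⊆ (S : Set ι) := fun i hi => by
    simp_all
  have hSvu : {u}ᶜ \ {v} ⊆ (S : Set ι) := fun i hi => by
    simp_all
  have key : ∀ s t, MeasurableSet s → MeasurableSet t →
      (fun y => κ (S.restrict y) (s ×ˢ t) * margDensity ρ f S y) =ᵐ[γ] fun y => G s y * H t y := by
    intro s t hs ht
    have hsm : Measurable fun y : ι → ℝ => s.indicator (1 : ℝ → ℝ≥0∞) (y u) :=
      (measurable_one.indicator hs).comp (measurable_pi_apply u)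
    have htm : Measurable fun y : ι → ℝ => t.indicator (1 : ℝ → ℝ≥0∞) (y v) :=
      (measurable_one.indicator ht).comp (measurable_pi_apply v)
    have hsd : DependsOn (fun y : ι → ℝ => s.indicator (1 : ℝ → ℝ≥0∞) (y u)) {v}ᶜ :=
      fun x y h => by simp only [h u huv]
    have htd : DependsOn (fun y : ι → ℝ => t.indicator (1 : ℝ → ℝ≥0∞) (y v)) {u}ᶜ :=
      fun x y h => by simp only [h v huv.symm]
    have hgm := hsm.mul hg
    have hhm := htm.mul hh
    have hgd := hsd.fun_mul hgv
    have hhd := htd.fun_mul hhu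
    refine condDistrib_mul_margDensity hY hf hlaw S hX (hs.prod ht)
      ((hgm.lmarginal _).mul (hhm.lmarginal _)) ?_ fun A hA => ?_
    · refine DependsOn.fun_mul ((hgd.lmarginal ρ {u}).mono ?_) ((hhd.lmarginal ρ {v}).mono ?_)
      · simpa using hSuv
      · simpa using hSvu
    have hAm : Measurable ((S.restrict ⁻¹' A).indicator (1 : (ι → ℝ) → ℝ≥0∞)) :=
      measurable_one.indicator (hr hA)
    have hAd : DependsOn ((S.restrict ⁻¹' A).indicator (1 : (ι → ℝ) → ℝ≥0∞)) (S : Set ι) :=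
      S.dependsOn_comp_restrict (A.indicator 1)
    have e := lintegral_mul_mul_lmarginal ρ (l := u) (m := v) hAm hgm hhm (hAd.mono hSu)
      (hAd.mono hSv) hgd hhd
    have e' := lintegral_comp_eq_lintegral_mul hY hf hlaw (hAm.mul (hsm.mul htm))
    have hms : MeasurableSet ((fun ω => S.restrict (Y ω)) ⁻¹' A ∩
      (fun ω => (Y ω u, Y ω v)) ⁻¹' s ×ˢ t) := (hrY hA).inter (hX (hs.prod ht))
    rw [← lintegral_indicator (hr hA), indicator_eq_indicator_one_mul]
    refine e.symm.trans (Eq.trans ?_ (e'.symm.trans ?_))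
    · refine lintegral_congr_ae ?_
      filter_upwards [hfgh] with y hy
      rw [hy]
      simp only [Pi.mul_apply]
      ring
    · rw [← lintegral_indicator_one hms]
      refine lintegral_congr fun ω => ?_
      have : (fun ω => (Y ω u, Y ω v)) ⁻¹' s ×ˢ t = {ω | Y ω u ∈ s} ∩ {ω | Y ω v ∈ t} := by
        ext; simp
      rw [this, inter_indicator_one, inter_indicator_one]
      rfl
  have hac : μ.map Y ≪ γ := hlaw ▸ withDensity_absolutelyContinuous _ _
  have hmul : ∀ᵐ ω ∂μ, κ (S.restrict (Y ω)) (s ×ˢ t) =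
      κ (S.restrict (Y ω)) (s ×ˢ univ) * κ (S.restrict (Y ω)) (univ ×ˢ t) := by
    have h1 : ∀ {P : (ι → ℝ) → Prop}, (∀ᵐ y ∂γ, P y) → ∀ᵐ ω ∂μ, P (Y ω) := fun hP =>
      ae_of_ae_map hY.aemeasurable (hac hP)
    filter_upwards [h1 (key s t hs ht), h1 (key s univ hs .univ), h1 (key univ t .univ ht),
      h1 (key univ univ .univ .univ), h1 (margDensity_lt_top hY hf hlaw S),
      ae_margDensity_ne_zero hY hf hlaw S] with ω a1 a2 a3 a4 a5 a6
    have hone : κ (S.restrict (Y ω)) (univ ×ˢ univ) = 1 := by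
      rw [univ_prod_univ]; exact measure_univ
    rw [hone, one_mul] at a4
    refine (ENNReal.mul_left_inj (mul_ne_zero a6 a6)
      (ENNReal.mul_ne_top a5.ne a5.ne)).1 ?_
    calc _ = (κ (S.restrict (Y ω)) (s ×ˢ t) * margDensity ρ f S (Y ω)) *
          margDensity ρ f S (Y ω) := by ring
      _ = (G s (Y ω) * H t (Y ω)) * (G univ (Y ω) * H univ (Y ω)) := by rw [a1, a4]
      _ = (G s (Y ω) * H univ (Y ω)) * (G univ (Y ω) * H t (Y ω)) := by ring
      _ = _ := by rw [← a2, ← a3]; ring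
  have c1 := condDistrib_ae_eq_condExp (μ := μ) hrY hX (hs.prod ht)
  have c2 := condDistrib_ae_eq_condExp (μ := μ) hrY hX (hs.prod (.univ (α := ℝ)))
  have c3 := condDistrib_ae_eq_condExp (μ := μ) hrY hX ((MeasurableSet.univ (α := ℝ)).prod ht)
  have p1 : (fun ω => (Y ω u, Y ω v)) ⁻¹' s ×ˢ t =
      (fun ω => Y ω u) ⁻¹' s ∩ (fun ω => Y ω v) ⁻¹' t := by ext; simp
  have p2 : (fun ω => (Y ω u, Y ω v)) ⁻¹' s ×ˢ univ = (fun ω => Y ω u) ⁻¹' s := by ext; simp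
  have p3 : (fun ω => (Y ω u, Y ω v)) ⁻¹' univ ×ˢ t = (fun ω => Y ω v) ⁻¹' t := by ext; simp
  rw [p1] at c1
  rw [p2] at c2
  rw [p3] at c3
  filter_upwards [c1, c2, c3, hmul] with ω b1 b2 b3 b4
  rw [Pi.mul_apply, ← b1, ← b2, ← b3, measureReal_def, measureReal_def, measureReal_def,
    ← ENNReal.toReal_mul, ← b4]

end Density

/-! ### The pairs of a regular vine -/

namespace Vine

variable {J : ℕ}

instance instFiniteNode (k : ℕ) : Finite (Node J k) := by
  induction k with
  | zero => exact inferInstanceAs (Finite (Fin J))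
  | succ k ih => exact inferInstanceAs (Finite (Sym2 (Node J k)))

theorem Node.vars_mk (k : ℕ) (a b : Node J k) :
    Node.vars (k + 1) (s(a, b) : Sym2 (Node J k)) = Node.vars k a ∪ Node.vars k b := rfl

/-- The symmetric difference of the complete unions of the two end points of an edge: the set of
its two conditioned variables. -/
def Node.diff (k : ℕ) (e : Sym2 (Node J k)) : Finset (Fin J) :=
  Sym2.lift ⟨fun a b => symmDiff (Node.vars k a) (Node.vars k b), fun _ _ => symmDiff_comm _ _⟩ e

end Vine

namespace RVine

open Vine

variable {J : ℕ} (V : RVine J)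

theorem ncard_edgeSet_add_one (k : ℕ) (hk : k + 1 < J) :
    (V.tree k).edgeSet.ncard + 1 = (V.tree k).verts.ncard := by
  classical
  have := Fintype.ofFinite (V.tree k).verts
  have := Fintype.ofFinite (V.tree k).coe.edgeSet
  have h := (V.isTree k hk).card_edgeFinset
  rw [← SimpleGraph.Subgraph.image_coe_edgeSet_coe,
    Set.ncard_image_of_injective _ (Sym2.map.injective Subtype.val_injective),
    ← Nat.card_coe_set_eq, ← Nat.card_coe_set_eq, Nat.card_eq_fintype_card,
    Nat.card_eq_fintype_card, ← h, SimpleGraph.edgeFinset_card]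

theorem ncard_edgeSet (k : ℕ) (hk : k + 1 < J) : (V.tree k).edgeSet.ncard = J - 1 - k := by
  induction k with
  | zero =>
    have h := V.ncard_edgeSet_add_one 0 hk
    rw [V.verts_zero, Set.ncard_univ] at h
    have : Nat.card (Node J 0) = J := Nat.card_fin J
    omega
  | succ k ih =>
    have h := V.ncard_edgeSet_add_one (k + 1) hk
    have e : (V.tree (k + 1)).verts.ncard = (V.tree k).edgeSet.ncard :=
      congrArg Set.ncard (V.verts_succ k hk)
    rw [e, ih (by omega)] at h
    omega

theorem exists_adj (k : ℕ) (hk : k + 1 < J) {a : Node J k} (ha : a ∈ (V.tree k).verts) :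
    ∃ b, (V.tree k).Adj a b := by
  have hn := V.ncard_edgeSet_add_one k hk
  rw [V.ncard_edgeSet k hk] at hn
  have : Nontrivial (V.tree k).verts :=
    Set.nontrivial_coe_sort.2 ((Set.one_lt_ncard (Set.toFinite _)).1 (by omega))
  obtain ⟨b, hb⟩ := (V.isTree k hk).connected.preconnected.exists_adj_of_nontrivial ⟨a, ha⟩
  exact ⟨b, hb⟩

/-- A node of a higher tree is an edge of the tree below. -/
theorem exists_adj_of_mem_verts_succ {k : ℕ} (hk : k + 2 < J) {a : Node J (k + 1)}
    (ha : a ∈ (V.tree (k + 1)).verts) :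
    ∃ x y : Node J k, a = (s(x, y) : Sym2 (Node J k)) ∧ (V.tree k).Adj x y := by
  rw [V.verts_succ k hk] at ha
  revert ha
  refine Sym2.ind (fun x y hxy => ?_) a
  exact ⟨x, y, rfl, hxy⟩

/-- The proximity condition, spelled out: the end points of an edge of a higher tree are edges
`{x, c}` and `{y, c}` of the tree below. -/
theorem exists_adj_of_adj_succ {k : ℕ} (hk : k + 2 < J) {a b : Node J (k + 1)}
    (hab : (V.tree (k + 1)).Adj a b) :
    ∃ x y c : Node J k, a = (s(x, c) : Sym2 (Node J k)) ∧ b = (s(y, c) : Sym2 (Node J k)) ∧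
      (V.tree k).Adj x c ∧ (V.tree k).Adj y c := by
  obtain ⟨x, y, ha, hxy⟩ := V.exists_adj_of_mem_verts_succ hk hab.fst_mem
  obtain ⟨z, w, hb, hzw⟩ := V.exists_adj_of_mem_verts_succ hk hab.snd_mem
  obtain ⟨c, hca, hcb⟩ := V.proximity k hk a b hab
  subst ha hb
  rcases Sym2.mem_iff.1 hca with rfl | rfl <;> rcases Sym2.mem_iff.1 hcb with rfl | rfl
  · exact ⟨y, w, c, Sym2.eq_swap, Sym2.eq_swap, hxy.symm, hzw.symm⟩
  · exact ⟨y, z, c, Sym2.eq_swap, rfl, hxy.symm, hzw⟩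
  · exact ⟨x, w, c, rfl, Sym2.eq_swap, hxy, hzw.symm⟩
  · exact ⟨x, z, c, rfl, rfl, hxy, hzw⟩

/-- Each side of an edge has at most one conditioned variable: with the end points `{x, c}` and
`{y, c}`, what `{x, c}` does not share with `{y, c}` is what `x` does not share with `c`. -/
theorem card_sdiff_le_one (k : ℕ) (hk : k + 1 < J) {a b : Node J k} (hab : (V.tree k).Adj a b) :
    (Node.vars k a \ Node.vars k b).card ≤ 1 := by
  induction k with
  | zero =>
    refine (Finset.card_le_card Finset.sdiff_subset).trans ?_
    simp [Node.vars]
  | succ k ih =>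
    obtain ⟨x, y, c, rfl, rfl, hx, hy⟩ := V.exists_adj_of_adj_succ hk hab
    refine (Finset.card_le_card ?_).trans (ih (by omega) hx)
    rw [Node.vars_mk, Node.vars_mk]
    intro i
    simp only [Finset.mem_sdiff, Finset.mem_union]
    tauto

theorem exists_mem_vars (k : ℕ) (hk : k + 1 < J) (i : Fin J) :
    ∃ a ∈ (V.tree k).verts, i ∈ Node.vars k a := by
  induction k with
  | zero => exact ⟨i, by simp [V.verts_zero], by simp [Node.vars]⟩
  | succ k ih =>
    obtain ⟨a, ha, hi⟩ := ih (by omega)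
    obtain ⟨b, hb⟩ := V.exists_adj k (by omega) ha
    refine ⟨(s(a, b) : Sym2 (Node J k)), ?_, ?_⟩
    · rw [V.verts_succ k hk]
      exact hb
    · rw [Node.vars_mk]
      exact Finset.mem_union_left _ hi

/-- Two variables that are reachable from the same edge are separated by that edge or by an edge of
an earlier tree. -/
theorem exists_separating (k : ℕ) (hk : k + 1 < J) {u v : Fin J} (huv : u ≠ v) {a b : Node J k}
    (hab : (V.tree k).Adj a b) (hu : u ∈ Node.vars k a ∪ Node.vars k b)
    (hv : v ∈ Node.vars k a ∪ Node.vars k b) :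
    ∃ i ≤ k, ∃ x y : Node J i, (V.tree i).Adj x y ∧ u ∈ Node.vars i x \ Node.vars i y ∧
      v ∈ Node.vars i y \ Node.vars i x := by
  induction k with
  | zero =>
    simp only [Node.vars, Finset.mem_union, Finset.mem_singleton] at hu hv
    rcases hu with rfl | rfl <;> rcases hv with rfl | rfl
    · exact absurd rfl huv
    · exact ⟨0, le_rfl, _, _, hab, by simpa [Node.vars] using huv,
        by simpa [Node.vars] using huv.symm⟩
    · exact ⟨0, le_rfl, _, _, hab.symm, by simpa [Node.vars] using huv,
        by simpa [Node.vars] using huv.symm⟩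
    · exact absurd rfl huv
  | succ k ih =>
    have down : ∀ c : Node J (k + 1), c ∈ (V.tree (k + 1)).verts → u ∈ Node.vars (k + 1) c →
        v ∈ Node.vars (k + 1) c → ∃ i ≤ k + 1, ∃ x y : Node J i, (V.tree i).Adj x y ∧
          u ∈ Node.vars i x \ Node.vars i y ∧ v ∈ Node.vars i y \ Node.vars i x := by
      intro c hc huc hvc
      obtain ⟨x, y, rfl, hxy⟩ := V.exists_adj_of_mem_verts_succ hk hc
      obtain ⟨i, hi, h⟩ := ih (by omega) hxy huc hvc
      exact ⟨i, by omega, h⟩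
    by_cases hua : u ∈ Node.vars (k + 1) a <;> by_cases hva : v ∈ Node.vars (k + 1) a
    · exact down a hab.fst_mem hua hva
    · by_cases hub : u ∈ Node.vars (k + 1) b
      · exact down b hab.snd_mem hub (by simpa [hva] using hv)
      · refine ⟨k + 1, le_rfl, a, b, hab, ?_, ?_⟩ <;> simp_all
    · by_cases hvb : v ∈ Node.vars (k + 1) b
      · exact down b hab.snd_mem (by simpa [hua] using hu) hvb
      · refine ⟨k + 1, le_rfl, b, a, hab.symm, ?_, ?_⟩ <;> simp_all
    · exact down b hab.snd_mem (by simpa [hua] using hu) (by simpa [hva] using hv)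

/-- The last tree consists of one edge, from which all variables are reachable. -/
theorem exists_adj_vars_eq_univ {k : ℕ} (hk : k + 2 = J) :
    ∃ a b : Node J k, (V.tree k).Adj a b ∧ Node.vars k a ∪ Node.vars k b = Finset.univ := by
  have h1 := V.ncard_edgeSet k (by omega)
  rw [show J - 1 - k = 1 by omega, Set.ncard_eq_one] at h1
  obtain ⟨e, he⟩ := h1
  induction e using Sym2.ind with | _ a b =>
  refine ⟨a, b, ?_, ?_⟩
  · rw [← SimpleGraph.Subgraph.mem_edgeSet, he]; rfl
  · ext i
    simp only [Finset.mem_univ, iff_true]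
    obtain ⟨c, hc, hi⟩ := V.exists_mem_vars k (by omega) i
    obtain ⟨d, hd⟩ := V.exists_adj k (by omega) hc
    rw [← SimpleGraph.Subgraph.mem_edgeSet, he, Set.mem_singleton_iff, Sym2.eq_iff] at hd
    rcases hd with ⟨rfl, rfl⟩ | ⟨rfl, rfl⟩
    · exact Finset.mem_union_left _ hi
    · exact Finset.mem_union_right _ hi

/-- The edges of all trees. -/
def edges : Finset (Σ k : Fin (J - 1), Sym2 (Node J k)) :=
  Finset.univ.sigma fun k => (Set.toFinite (V.tree k).edgeSet).toFinset

theorem mem_edges {k : Fin (J - 1)} {e : Sym2 (Node J k)} :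
    (⟨k, e⟩ : Σ k : Fin (J - 1), Sym2 (Node J k)) ∈ V.edges ↔ e ∈ (V.tree k).edgeSet := by
  simp [edges]

theorem card_edges : V.edges.card = J.choose 2 := by
  have h : ∀ k : Fin (J - 1), (Set.toFinite (V.tree k).edgeSet).toFinset.card = J - 1 - k :=
    fun k => by
      rw [← Set.ncard_eq_toFinset_card]
      exact V.ncard_edgeSet k (by omega)
  rw [edges, Finset.card_sigma, Finset.sum_congr rfl fun k _ => h k,
    Fin.sum_univ_eq_sum_range (fun k => J - 1 - k) (J - 1)]
  rcases J with _ | n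
  · rfl
  · simp only [Nat.add_sub_cancel]
    have h1 : ∑ k ∈ Finset.range n, (n - k) = ∑ k ∈ Finset.range n, (k + 1) := by
      rw [← Finset.sum_range_reflect]
      refine Finset.sum_congr rfl fun k hk => ?_
      have := Finset.mem_range.1 hk
      omega
    have h2 := Finset.sum_range_succ' (fun k => k) n
    rw [Finset.sum_range_id, add_zero] at h2
    rw [h1, ← h2, Nat.choose_two_right]

theorem sdiff_eq_singleton {k : ℕ} (hk : k + 1 < J) {a b : Node J k} (hab : (V.tree k).Adj a b)
    {u : Fin J} (hu : u ∈ Node.vars k a \ Node.vars k b) :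
    Node.vars k a \ Node.vars k b = {u} :=
  (Finset.eq_of_subset_of_card_le (Finset.singleton_subset_iff.2 hu)
    (by simpa using V.card_sdiff_le_one k hk hab)).symm

theorem diff_eq_pair {k : ℕ} {a b : Node J k} {u v : Fin J}
    (hu : Node.vars k a \ Node.vars k b = {u}) (hv : Node.vars k b \ Node.vars k a = {v}) :
    Node.diff k s(a, b) = {u, v} := by
  change symmDiff (Node.vars k a) (Node.vars k b) = _
  rw [symmDiff_def, hu, hv]
  rfl

/-- Every pair of variables is the pair of conditioned variables of some edge. -/
theorem powersetCard_subset_image_edges :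
    Finset.powersetCard 2 Finset.univ ⊆
      V.edges.image fun e => Node.diff (e.1 : ℕ) e.2 := by
  intro S hS
  obtain ⟨u, v, huv, rfl⟩ := Finset.card_eq_two.1 (Finset.mem_powersetCard.1 hS).2
  have hJ : 2 ≤ J := by
    have := u.isLt
    have := v.isLt
    have : (u : ℕ) ≠ v := fun h => huv (Fin.ext h)
    omega
  obtain ⟨a, b, hab, hU⟩ := V.exists_adj_vars_eq_univ (k := J - 2) (by omega)
  obtain ⟨i, hi, x, y, hxy, hu, hv⟩ := V.exists_separating (J - 2) (by omega) huv hab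
    (by simp [hU]) (by simp [hU])
  refine Finset.mem_image.2 ⟨⟨⟨i, by omega⟩, s(x, y)⟩, V.mem_edges.2 hxy, ?_⟩
  exact diff_eq_pair (V.sdiff_eq_singleton (by omega) hxy hu)
    (V.sdiff_eq_singleton (by omega) hxy.symm hv)

/-- There are as many edges as pairs of variables and all pairs occur, so every edge has exactly two
conditioned variables. -/
theorem image_edges :
    (V.edges.image fun e => Node.diff (e.1 : ℕ) e.2) = Finset.powersetCard 2 Finset.univ := by
  refine (Finset.eq_of_subset_of_card_le V.powersetCard_subset_image_edges ?_).symm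
  refine Finset.card_image_le.trans ?_
  rw [V.card_edges, Finset.card_powersetCard, Finset.card_univ, Fintype.card_fin]

/-- Different edges have different pairs of conditioned variables. -/
theorem injOn_diff_edges :
    Set.InjOn (fun e : Σ k : Fin (J - 1), Sym2 (Node J k) => Node.diff (e.1 : ℕ) e.2) V.edges := by
  rw [← Finset.card_image_iff, V.image_edges, V.card_edges, Finset.card_powersetCard,
    Finset.card_univ, Fintype.card_fin]

theorem exists_isPair {k : ℕ} (hk : k + 1 < J) {a b : Node J k} (hab : (V.tree k).Adj a b) :
    ∃ l m, V.IsPair k a b l m := by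
  have h : Node.diff k s(a, b) ∈ V.edges.image fun e => Node.diff (e.1 : ℕ) e.2 :=
    Finset.mem_image.2 ⟨⟨⟨k, by omega⟩, s(a, b)⟩, V.mem_edges.2 hab, rfl⟩
  rw [V.image_edges, Finset.mem_powersetCard] at h
  have h2 : (symmDiff (Node.vars k a) (Node.vars k b)).card = 2 := h.2
  have h3 : (symmDiff (Node.vars k a) (Node.vars k b)).card ≤ _ := Finset.card_union_le _ _
  have h4 := V.card_sdiff_le_one k hk hab
  have h5 := V.card_sdiff_le_one k hk hab.symm
  obtain ⟨l, hl⟩ := Finset.card_eq_one.1 (by omega : (Node.vars k a \ Node.vars k b).card = 1)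
  obtain ⟨m, hm⟩ := Finset.card_eq_one.1 (by omega : (Node.vars k b \ Node.vars k a).card = 1)
  exact ⟨l, m, hab, hl, hm⟩

theorem IsPair.ne {k : ℕ} {a b : Node J k} {u v : Fin J} (h : V.IsPair k a b u v) : u ≠ v := by
  rintro rfl
  have h1 : u ∈ Node.vars k a \ Node.vars k b := h.2.1 ▸ Finset.mem_singleton_self u
  have h2 : u ∈ Node.vars k b \ Node.vars k a := h.2.2 ▸ Finset.mem_singleton_self u
  exact (Finset.mem_sdiff.1 h1).2 (Finset.mem_sdiff.1 h2).1

/-- The two variables of a pair are not reachable from one and the same edge of an earlier tree. -/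
theorem IsPair.notMem_vars {k : ℕ} (hk : k + 1 < J) {a b : Node J k} {u v : Fin J}
    (h : V.IsPair k a b u v) {i : ℕ} (hi : i < k) {x y : Node J i} (hxy : (V.tree i).Adj x y)
    (hu : u ∈ Node.vars i x ∪ Node.vars i y) : v ∉ Node.vars i x ∪ Node.vars i y := by
  intro hv
  obtain ⟨i', hi', x', y', hxy', hu', hv'⟩ := V.exists_separating i (by omega) (h.ne V) hxy hu hv
  have e1 := diff_eq_pair (V.sdiff_eq_singleton (by omega) hxy' hu')
    (V.sdiff_eq_singleton (by omega) hxy'.symm hv')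
  have e2 := diff_eq_pair h.2.1 h.2.2
  have := V.injOn_diff_edges
    (x₁ := ⟨⟨i', by omega⟩, s(x', y')⟩) (V.mem_edges.2 hxy')
    (x₂ := ⟨⟨k, by omega⟩, s(a, b)⟩) (V.mem_edges.2 h.1) (e1.trans e2.symm)
  have : i' = k := congrArg (fun e => (e.1 : ℕ)) this
  omega

/-- The conditioning set of an edge is the set of variables reachable from the node that its two end
points have in common. -/
theorem exists_vars_eq_inter {k : ℕ} (hk : k + 2 < J) {a b : Node J (k + 1)}
    (hab : (V.tree (k + 1)).Adj a b) :
    ∃ c ∈ (V.tree k).verts, Node.vars (k + 1) a ∩ Node.vars (k + 1) b = Node.vars k c := by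
  obtain ⟨l, m, -, hl, hm⟩ := V.exists_isPair hk hab
  obtain ⟨x, y, c, rfl, rfl, hx, hy⟩ := V.exists_adj_of_adj_succ hk hab
  refine ⟨c, hx.snd_mem, ?_⟩
  rw [Node.vars_mk, Node.vars_mk] at hl hm ⊢
  -- A common variable of `{x, c}` and `{y, c}` outside `c` would be the only variable of `x`
  -- outside `c`, but this is the conditioned variable `l`, which is not in `{y, c}`.
  have hl' : l ∈ (Node.vars k x ∪ Node.vars k c) \ (Node.vars k y ∪ Node.vars k c) :=
    hl ▸ Finset.mem_singleton_self l
  simp only [Finset.mem_sdiff, Finset.mem_union, not_or] at hl'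
  ext z
  simp only [Finset.mem_inter, Finset.mem_union]
  refine ⟨fun hz => ?_, fun hz => ⟨Or.inr hz, Or.inr hz⟩⟩
  by_contra hzc
  have hzx : z ∈ Node.vars k x := hz.1.resolve_right hzc
  have hlx : l ∈ Node.vars k x := hl'.1.resolve_right hl'.2.2
  have : z = l := Finset.card_le_one.1 (V.card_sdiff_le_one k (by omega) hx) z
    (Finset.mem_sdiff.2 ⟨hzx, hzc⟩) l (Finset.mem_sdiff.2 ⟨hlx, hl'.2.2⟩)
  exact hl'.2.1 (this ▸ hz.2.resolve_right hzc)

end RVine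

/-! ### Factorization of the joint density -/

/-- If the law `ν` on the plane has the independence copula, it is the product of its margins. -/
theorem Vine.BivCopula.IsCopulaOf.eq_prod {ν : Measure (ℝ × ℝ)} [IsProbabilityMeasure ν]
    (h : BivCopula.indep.IsCopulaOf ν) (s t : Set ℝ) :
    ν (s ×ˢ t) = ν (s ×ˢ univ) * ν (univ ×ˢ t) := by
  have e : ν.fst.prod ν.snd = ν := by
    have hU : ⋃ n : ℕ, Iic (n : ℝ) = univ :=
      eq_univ_of_forall fun x => mem_iUnion.2 (exists_nat_ge x)
    refine Measure.prod_eq_generateFrom (borel_eq_generateFrom_Iic ℝ).symm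
      (borel_eq_generateFrom_Iic ℝ).symm isPiSystem_Iic isPiSystem_Iic
      ⟨fun n => Iic n, fun n => mem_range_self _, fun n => measure_lt_top _ _, hU⟩
      ⟨fun n => Iic n, fun n => mem_range_self _, fun n => measure_lt_top _ _, hU⟩ ?_
    rintro _ ⟨s, rfl⟩ _ ⟨t, rfl⟩
    have hst : ν.real (Iic s ×ˢ Iic t) = cdf ν.fst s * cdf ν.snd t := h s t
    rw [cdf_eq_real, cdf_eq_real] at hst
    rw [← ENNReal.toReal_eq_toReal_iff' (measure_ne_top _ _)
      (ENNReal.mul_ne_top (measure_ne_top _ _) (measure_ne_top _ _)), ENNReal.toReal_mul]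
    exact hst
  have e1 : ν (s ×ˢ univ) = ν.fst s := by
    rw [← e]; simp
  have e2 : ν (univ ×ˢ t) = ν.snd t := by
    rw [← e]; simp
  rw [e1, e2, ← Measure.prod_prod, e]

/-- The density `p` splits into a factor that does not depend on the coordinate `v` and one that
does not depend on the coordinate `u`. The factors take values in `ℝ≥0`, where inverses are
multiplicative without exception. -/
def Splits {ι : Type*} (γ : Measure (ι → ℝ)) (u v : ι) (p : (ι → ℝ) → ℝ≥0∞) : Prop :=
  ∃ g h : (ι → ℝ) → NNReal, Measurable g ∧ Measurable h ∧ DependsOn g {v}ᶜ ∧ DependsOn h {u}ᶜ ∧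
    (fun y => (p y).toNNReal) =ᵐ[γ] fun y => g y * h y

section Splits

variable {ι : Type*} {γ : Measure (ι → ℝ)} {u v : ι} {p q r : (ι → ℝ) → ℝ≥0∞}

theorem Splits.of_dependsOn {S : Set ι} (hp : Measurable p) (hpS : DependsOn p S)
    (h : u ∈ S → v ∉ S) : Splits γ u v p := by
  by_cases hu : u ∈ S
  · refine ⟨fun y => (p y).toNNReal, fun _ => 1, hp.ennreal_toNNReal, measurable_const,
      fun x y hxy => ?_, fun _ _ _ => rfl, by simp⟩
    exact congrArg ENNReal.toNNReal (hpS fun i hi => hxy i fun hiv => h hu (hiv ▸ hi))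
  · refine ⟨fun _ => 1, fun y => (p y).toNNReal, measurable_const, hp.ennreal_toNNReal,
      fun _ _ _ => rfl, fun x y hxy => ?_, by simp⟩
    exact congrArg ENNReal.toNNReal (hpS fun i hi => hxy i fun hiu => hu (hiu ▸ hi))

theorem Splits.mul (hp : Splits γ u v p) (hq : Splits γ u v q) :
    Splits γ u v fun y => p y * q y := by
  obtain ⟨g, h, hg, hh, hgv, hhu, e⟩ := hp
  obtain ⟨g', h', hg', hh', hgv', hhu', e'⟩ := hq
  refine ⟨fun y => g y * g' y, fun y => h y * h' y, hg.mul hg', hh.mul hh',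
    fun x y hxy => congrArg₂ (· * ·) (hgv hxy) (hgv' hxy),
    fun x y hxy => congrArg₂ (· * ·) (hhu hxy) (hhu' hxy), ?_⟩
  filter_upwards [e, e'] with y h1 h2
  rw [ENNReal.toNNReal_mul, h1, h2]
  ring

theorem Splits.inv (hp : Splits γ u v p) : Splits γ u v fun y => (p y)⁻¹ := by
  obtain ⟨g, h, hg, hh, hgv, hhu, e⟩ := hp
  refine ⟨fun y => (g y)⁻¹, fun y => (h y)⁻¹, hg.inv, hh.inv,
    fun x y hxy => congrArg (·⁻¹) (hgv hxy), fun x y hxy => congrArg (·⁻¹) (hhu hxy), ?_⟩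
  filter_upwards [e] with y h1
  rw [ENNReal.toNNReal_inv, h1, mul_inv]

theorem Splits.congr (hp : Splits γ u v p) (h : q =ᵐ[γ] p) : Splits γ u v q := by
  obtain ⟨g, h', hg, hh, hgv, hhu, e⟩ := hp
  refine ⟨g, h', hg, hh, hgv, hhu, ?_⟩
  filter_upwards [h, e] with y h1 h2
  rw [h1, h2]

end Splits

/-- An edge with the independence copula makes the density of its variables a quotient of the
densities that belong to its end points and to its conditioning set. -/
theorem IsRVineDistribution.margDensity_edge {J : ℕ} {Ω : Type*} [MeasurableSpace Ω]
    {μ : Measure Ω} [IsProbabilityMeasure μ] {Y : Ω → Fin J → ℝ} {F : Fin J → Measure ℝ}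
    {V : RVine J} {B : (k : ℕ) → Vine.Node J k → Vine.Node J k → Vine.BivCopula}
    (hY : IsRVineDistribution μ Y F V B) {ρ : Measure ℝ} [IsProbabilityMeasure ρ]
    {f : (Fin J → ℝ) → ℝ≥0∞} (hf : Measurable f)
    (hlaw : μ.map Y = (Measure.pi fun _ => ρ).withDensity f) {k : ℕ} (hk : k + 1 < J)
    {a b : Vine.Node J k} (hab : (V.tree k).Adj a b) (hB : B k a b = Vine.BivCopula.indep) :
    margDensity ρ f (Vine.Node.vars k a ∪ Vine.Node.vars k b) =ᵐ[Measure.pi fun _ => ρ] fun y =>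
      margDensity ρ f (Vine.Node.vars k a) y * margDensity ρ f (Vine.Node.vars k b) y *
        (margDensity ρ f (Vine.Node.vars k a ∩ Vine.Node.vars k b) y)⁻¹ := by
  obtain ⟨l, m, h⟩ := V.exists_isPair hk hab
  have hla : l ∈ Vine.Node.vars k a \ Vine.Node.vars k b := h.2.1 ▸ Finset.mem_singleton_self l
  have hmb : m ∈ Vine.Node.vars k b \ Vine.Node.vars k a := h.2.2 ▸ Finset.mem_singleton_self m
  have hs := hY.pairCopula k hk a b l m h
  rw [hB] at hs
  unfold RVine.condSet at hs
  have hpa : Vine.Node.vars k a = insert l (Vine.Node.vars k a ∩ Vine.Node.vars k b) := by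
    rw [Finset.insert_eq, ← h.2.1, Finset.sdiff_union_inter]
  have hpb : Vine.Node.vars k b = insert m (Vine.Node.vars k a ∩ Vine.Node.vars k b) := by
    rw [Finset.insert_eq, ← h.2.2, Finset.inter_comm, Finset.sdiff_union_inter]
  have hpu : Vine.Node.vars k a ∪ Vine.Node.vars k b =
      insert l (insert m (Vine.Node.vars k a ∩ Vine.Node.vars k b)) := by
    rw [← hpb, Finset.insert_eq, ← h.2.1, Finset.sdiff_union_self_eq_union]
  simp only [Finset.mem_sdiff] at hla hmb
  have key := margDensity_insert_insert (D := Vine.Node.vars k a ∩ Vine.Node.vars k b)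
    hY.measurable hf hlaw (l := l) (m := m) (fun e => hmb.2 (e ▸ hla.1)) (by simp [hla.2])
    (by simp [hmb.2]) (by
      filter_upwards [hs] with w hw s t _ _
      exact hw.eq_prod s t)
  rwa [← hpu, ← hpa, ← hpb] at key

/-- The density of the variables reachable from a node or an edge splits as soon as no edge of the
trees before `V.tree j` reaches both `u` and `v`, and the copulas of all other trees are the
independence copula. -/
theorem IsRVineDistribution.splits_margDensity {J : ℕ} {Ω : Type*} [MeasurableSpace Ω]
    {μ : Measure Ω} [IsProbabilityMeasure μ] {Y : Ω → Fin J → ℝ} {F : Fin J → Measure ℝ}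
    {V : RVine J} {B : (k : ℕ) → Vine.Node J k → Vine.Node J k → Vine.BivCopula}
    (hY : IsRVineDistribution μ Y F V B) {ρ : Measure ℝ} [IsProbabilityMeasure ρ]
    {f : (Fin J → ℝ) → ℝ≥0∞} (hf : Measurable f)
    (hlaw : μ.map Y = (Measure.pi fun _ => ρ).withDensity f) {j : ℕ}
    (hB : ∀ k, j ≤ k → k + 1 < J → ∀ a b : Vine.Node J k, (V.tree k).Adj a b →
      B k a b = Vine.BivCopula.indep) {u v : Fin J} (huv : u ≠ v)
    (hsep : ∀ i < j, i + 1 < J → ∀ x y : Vine.Node J i, (V.tree i).Adj x y →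
      u ∈ Vine.Node.vars i x ∪ Vine.Node.vars i y → v ∉ Vine.Node.vars i x ∪ Vine.Node.vars i y)
    (k : ℕ) (hk : k + 1 < J) :
    (∀ a ∈ (V.tree k).verts,
      Splits (Measure.pi fun _ => ρ) u v (margDensity ρ f (Vine.Node.vars k a))) ∧
    ∀ a b, (V.tree k).Adj a b → Splits (Measure.pi fun _ => ρ) u v
      (margDensity ρ f (Vine.Node.vars k a ∪ Vine.Node.vars k b)) := by
  have base : ∀ S : Finset (Fin J), (u ∈ S → v ∉ S) →
      Splits (Measure.pi fun _ => ρ) u v (margDensity ρ f S) := fun S hS =>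
    .of_dependsOn (measurable_margDensity hf S) (dependsOn_margDensity S) (by simpa using hS)
  have step : ∀ k, k + 1 < J →
      (∀ a ∈ (V.tree k).verts,
        Splits (Measure.pi fun _ => ρ) u v (margDensity ρ f (Vine.Node.vars k a))) →
      (∀ a b, (V.tree k).Adj a b → Splits (Measure.pi fun _ => ρ) u v
        (margDensity ρ f (Vine.Node.vars k a ∩ Vine.Node.vars k b))) →
      ∀ a b, (V.tree k).Adj a b → Splits (Measure.pi fun _ => ρ) u v
        (margDensity ρ f (Vine.Node.vars k a ∪ Vine.Node.vars k b)) := by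
    intro k hk h1 h2 a b hab
    by_cases hkj : k < j
    · exact base _ (hsep k hkj hk a b hab)
    · exact (((h1 a hab.fst_mem).mul (h1 b hab.snd_mem)).mul (h2 a b hab).inv).congr
        (hY.margDensity_edge hf hlaw hk hab (hB k (not_lt.1 hkj) hk a b hab))
  induction k with
  | zero =>
    have h0 : ∀ S : Finset (Fin J), S.card ≤ 1 →
        Splits (Measure.pi fun _ => ρ) u v (margDensity ρ f S) := fun S hS =>
      base S fun hu hv => huv (Finset.card_le_one.1 hS u hu v hv)
    refine ⟨fun a _ => h0 _ (by simp [Vine.Node.vars]), step 0 hk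
      (fun a _ => h0 _ (by simp [Vine.Node.vars])) fun a b _ => h0 _ ?_⟩
    exact (Finset.card_le_card Finset.inter_subset_left).trans (by simp [Vine.Node.vars])
  | succ k ih =>
    obtain ⟨ih1, ih2⟩ := ih (by omega)
    have h1 : ∀ a ∈ (V.tree (k + 1)).verts, Splits (Measure.pi fun _ => ρ) u v
        (margDensity ρ f (Vine.Node.vars (k + 1) a)) := by
      intro a ha
      obtain ⟨x, y, rfl, hxy⟩ := V.exists_adj_of_mem_verts_succ hk ha
      exact ih2 x y hxy
    refine ⟨h1, step (k + 1) hk h1 fun a b hab => ?_⟩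
    obtain ⟨c, hc, e⟩ := V.exists_vars_eq_inter hk hab
    rw [e]
    exact ih1 c hc

theorem theorem1 {J : ℕ} {Ω : Type*} [MeasurableSpace Ω]
    (μ : Measure Ω) [IsProbabilityMeasure μ] (Y : Ω → Fin J → ℝ)
    (F : Fin J → Measure ℝ) (V : RVine J)
    (B : (k : ℕ) → Vine.Node J k → Vine.Node J k → Vine.BivCopula)
    (hY : IsRVineDistribution μ Y F V B)
    (j : ℕ)
    (hB : ∀ k, j ≤ k → k + 1 < J → ∀ a b : Vine.Node J k, (V.tree k).Adj a b →
      B k a b = Vine.BivCopula.indep)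
    (k : ℕ) (hjk : j ≤ k) (hkJ : k + 1 < J) (a b : Vine.Node J k) (u v : Fin J)
    (huv : V.IsPair k a b u v) :
    CondIndepGiven μ (fun ω => Y ω u) (fun ω => Y ω v)
      (fun ω => (({u, v} : Finset (Fin J))ᶜ).restrict (Y ω)) := by
  have hne : u ≠ v := huv.ne V
  have hYm := hY.measurable
  have := hY.hasPDF
  have : IsProbabilityMeasure (μ.map Y) := Measure.isProbabilityMeasure_map hYm.aemeasurable
  set γ : Measure (Fin J → ℝ) := Measure.pi fun _ => gaussianReal 0 1
  have hac : μ.map Y ≪ γ :=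
    (HasPDF.absolutelyContinuous (X := Y)).trans volume_absolutelyContinuous_pi_gaussianReal
  have hf : Measurable ((μ.map Y).rnDeriv γ) := Measure.measurable_rnDeriv _ _
  have hlaw : μ.map Y = γ.withDensity ((μ.map Y).rnDeriv γ) :=
    (Measure.withDensity_rnDeriv_eq _ _ hac).symm
  -- The edge of the last tree reaches all variables, so its density is the joint density.
  obtain ⟨x, y, hxy, hU⟩ := V.exists_adj_vars_eq_univ (k := J - 2) (by omega)
  have h := (hY.splits_margDensity hf hlaw hB hne
    (fun i hi hiJ x y hxy hu => huv.notMem_vars V hkJ (hi.trans_le hjk) hxy hu)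
    (J - 2) (by omega)).2 x y hxy
  rw [hU, margDensity_univ] at h
  obtain ⟨g, h, hg, hh, hgv, hhu, e⟩ := h
  refine condIndepGiven_of_density_eq_mul hYm hf hlaw hne hg.coe_nnreal_ennreal
    hh.coe_nnreal_ennreal (fun x y hxy => by simp only [hgv hxy])
    (fun x y hxy => by simp only [hhu hxy]) ?_
  filter_upwards [e, Measure.rnDeriv_lt_top (μ.map Y) γ] with z h1 h2
  rw [← ENNReal.coe_mul, ← h1, ENNReal.coe_toNNReal h2.ne]
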